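/- **Theorem 3.3 (Logarithmic Hardy–Sobolev inequality).** Let $N\ge 3$ and let $\Omega\subset\mathbb{R}^N$ be a bounded domain (nonempty, open and connected) with boundary of class $C^2$ and with $0\in\Omega$. Write $d(x)=\operatorname{dist}(x,\partial\Omega)$ and $\|u\|_2=\left(\int_\Omega u^2\,dx\right)^{1/2}$. Then there is a constant $K_3>0$ (independent of $u$ and $\varepsilon$) such that for every $u\in C_c^\infty(\Omega\setminus\{0\})$ with $u\ge 0$ and every $\varepsilon>0$, $$\int_\Omega u^2\log\left(\frac{u}{\|u\|_2\,|x|^{\frac{2-N}{2}}\,d(x)}\right)dx\;\le\;\varepsilon\int_\Omega\left(|\nabla u|^2-\frac{(N-2)^2}{4|x|^2}\,u^2\right)dx+\left(K_3-\frac{N+2}{4}\log\varepsilon\right)\|u\|_2^2,$$ where the integrand on the left is understood to be $0$ wherever $u=0$. -/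

import Mathlib

open scoped ContDiff

/-- `Ω` has a boundary of class `C²`: near every boundary point `p` there is a unit vector `ν`
such that, in the orthogonal coordinates `(y, s)` with `s = ⟪ν, x⟫` and
`y = x - ⟪ν, x⟫ ν ∈ ν^⊥`, the set `Ω` is exactly the region `s < a y` below the graph of a
`C²` function `a`. Only the values of `a` on the hyperplane `ν^⊥` are used. -/
def HasC2Boundary {E : Type*} [NormedAddCommGroup E] [InnerProductSpace ℝ E]
    (Ω : Set E) : Prop :=
  ∀ p ∈ frontier Ω, ∃ (ν : E) (a : E → ℝ) (r : ℝ),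
    ‖ν‖ = 1 ∧ ContDiff ℝ 2 a ∧ 0 < r ∧
      ∀ x ∈ Metric.ball p r, x ∈ Ω ↔ inner ℝ ν x < a (x - inner ℝ ν x • ν)

/-- A bounded domain (open, connected, nonempty set) of class `C²`. -/
structure IsC2BoundedDomain {E : Type*} [NormedAddCommGroup E] [InnerProductSpace ℝ E]
    (Ω : Set E) : Prop where
  isOpen : IsOpen Ω
  isConnected : IsConnected Ω
  isBounded : Bornology.IsBounded Ω
  hasC2Boundary : HasC2Boundary Ω

/-- The distance `d(x) = dist(x, ∂Ω)` to the boundary. -/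
noncomputable def distBoundary {E : Type*} [NormedAddCommGroup E]
    (Ω : Set E) (x : E) : ℝ :=
  Metric.infDist x (frontier Ω)

/-- `u ∈ C_c^∞(U)`, with `u` extended by zero to the whole space: `u` is smooth and its support
is a compact subset of `U`. -/
def IsTestFunctionOn {E : Type*} [NormedAddCommGroup E] [NormedSpace ℝ E]
    (U : Set E) (u : E → ℝ) : Prop :=
  ContDiff ℝ ∞ u ∧ HasCompactSupport u ∧ tsupport u ⊆ U

/-- The `L²(Ω)` norm `‖u‖₂ = (∫_Ω u² dx)^{1/2}`, used for `u ∈ C_c^∞(Ω)`. -/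
noncomputable def l2NormOn {N : ℕ} (Ω : Set (EuclideanSpace ℝ (Fin N)))
    (u : EuclideanSpace ℝ (Fin N) → ℝ) : ℝ :=
  Real.sqrt (∫ x in Ω, u x ^ 2)

/-! Put `A = ‖u‖₂` and `X = (u/A)^(4/(N-2)) |x|²`. The logarithm on the left equals `(N-2)/4 · log X
+ 1/2 · log d⁻²`. Since `log` is concave, each piece lies below a tangent line, whose slopes `l` and
`m` are left free (`sq_mul_log_le`). After integration against `u²` only three quantities remain: `∫
u²`, `∫ u²/d²`, and the critical Sobolev integral of `w = |x|^a u` with `a = (N-2)/N`.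

All three are controlled by the Hardy form `Q` with its sharp constant
(`IsC2BoundedDomain.exists_hardyForm_bounds`). The ground state representation writes `Q` as the
integral of a square (`hardyForm_eq`). Although `Q` does not control the full gradient of `u`,
testing against `|x|^(2a-2) x` shows that it controls `∫ |x|^(2a-2) u²` for every `a > 0`, and hence
the `H¹` norm of `|x|^a u`. The Sobolev inequality and the boundary Hardy inequality
(`HasC2Boundary.exists_hardy`) are then applied to `w`; near the origin, where `w` loses information
about `u`, `d` is bounded below.

The boundary inequality is one-dimensional: in each graph chart one integrates by parts in the
vertical direction, and compactness of the boundary glues the charts. Finally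
`log_bound_of_forall_parameters` chooses the slopes; `log ε` is collected with weight `N/4` from the
Sobolev term and `1/2` from the boundary term, in total `(N+2)/4`. -/

open MeasureTheory

/-! ### Products with weights singular off the support; integration by parts. -/

section Calculus

variable {E : Type*} [NormedAddCommGroup E] [NormedSpace ℝ E]

/-- A product is smooth if one factor is smooth and the other is smooth on its support. -/
theorem ContDiff.mul_of_contDiffAt_tsupport {n : WithTop ℕ∞} {φ f : E → ℝ}
    (hf : ContDiff ℝ n f) (hφ : ∀ x ∈ tsupport f, ContDiffAt ℝ n φ x) :
    ContDiff ℝ n (fun x => φ x * f x) := by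
  rw [contDiff_iff_contDiffAt]
  intro x
  by_cases hx : x ∈ tsupport f
  · exact (hφ x hx).mul hf.contDiffAt
  · have h0 : f =ᶠ[nhds x] 0 := notMem_tsupport_iff_eventuallyEq.mp hx
    have : (fun x => φ x * f x) =ᶠ[nhds x] fun _ => 0 := by
      filter_upwards [h0] with y hy
      simp [hy]
    exact contDiffAt_const.congr_of_eventuallyEq this

theorem Continuous.mul_of_continuousAt_tsupport {X : Type*} [TopologicalSpace X] {φ f : X → ℝ}
    (hf : Continuous f) (hφ : ∀ x ∈ tsupport f, ContinuousAt φ x) :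
    Continuous (fun x => φ x * f x) := by
  rw [continuous_iff_continuousAt]
  intro x
  by_cases hx : x ∈ tsupport f
  · exact (hφ x hx).mul hf.continuousAt
  · have h0 : f =ᶠ[nhds x] 0 := notMem_tsupport_iff_eventuallyEq.mp hx
    have : (fun x => φ x * f x) =ᶠ[nhds x] fun _ => 0 := by
      filter_upwards [h0] with y hy
      simp [hy]
    exact (continuousAt_const (y := (0 : ℝ))).congr this.symm

theorem integrable_mul_of_continuousAt_tsupport {X : Type*} [TopologicalSpace X]
    [MeasurableSpace X] [OpensMeasurableSpace X] {μ : Measure X} [IsFiniteMeasureOnCompacts μ]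
    {φ f : X → ℝ} (hf : Continuous f)
    (hfc : HasCompactSupport f) (hφ : ∀ x ∈ tsupport f, ContinuousAt φ x) :
    Integrable (fun x => φ x * f x) μ :=
  (hf.mul_of_continuousAt_tsupport hφ).integrable_of_hasCompactSupport hfc.mul_left

variable [MeasurableSpace E] [BorelSpace E] {μ : Measure E} [FiniteDimensional ℝ E] [μ.IsAddHaarMeasure]

/-- Integration by parts against the constant function `1`. -/
theorem integral_fderiv_apply_eq_zero {h : E → ℝ} (hh : ContDiff ℝ 1 h)
    (hc : HasCompactSupport h) (v : E) : ∫ x, fderiv ℝ h x v ∂μ = 0 := by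
  have hd : Integrable (fun x => fderiv ℝ h x v) μ :=
    ((hh.continuous_fderiv one_ne_zero).clm_apply continuous_const).integrable_of_hasCompactSupport
      (hc.fderiv_apply ℝ v)
  have hi : Integrable h μ := hh.continuous.integrable_of_hasCompactSupport hc
  have := integral_mul_fderiv_eq_neg_fderiv_mul_of_integrable (μ := μ) (𝕜 := ℝ)
    (f := fun _ => (1 : ℝ)) (g := h) (v := v) (by simp) (by simpa using hd) (by simpa using hi)
    (fun x _ => by fun_prop) (fun x _ => hh.differentiable one_ne_zero x)
  simpa using this

end Calculus

/-! ### Dilation fields and powers of the norm. -/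

section Euler

variable {N : ℕ}

/-- Euler's identity: the dilation field has constant divergence `N`. -/
theorem integral_fderiv_self_eq {h : EuclideanSpace ℝ (Fin N) → ℝ} (hh : ContDiff ℝ 1 h)
    (hc : HasCompactSupport h) : ∫ x, fderiv ℝ h x x = -(N * ∫ x, h x) := by
  let e := EuclideanSpace.basisFun (Fin N) ℝ
  have hi : Integrable h := hh.continuous.integrable_of_hasCompactSupport hc
  -- The exact derivative `∂ᵢ(xᵢ h) = xᵢ ∂ᵢh + h` has zero integral; summing over `i` produces the
  -- factor `N`.
  have hcoord (i : Fin N) : ∫ x, x i * fderiv ℝ h x (e i) = - ∫ x, h x := by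
    have hp : ContDiff ℝ 1 (fun x : EuclideanSpace ℝ (Fin N) => x i) := by fun_prop
    have h0 := integral_fderiv_apply_eq_zero (μ := volume) (hp.mul hh) hc.mul_left (e i)
    have hd : ∀ x, fderiv ℝ (fun x => x i * h x) x (e i) = x i * fderiv ℝ h x (e i) + h x := by
      intro x
      have h1 : HasFDerivAt (fun x : EuclideanSpace ℝ (Fin N) => x i)
          (EuclideanSpace.proj i : EuclideanSpace ℝ (Fin N) →L[ℝ] ℝ) x :=
        (EuclideanSpace.proj i : EuclideanSpace ℝ (Fin N) →L[ℝ] ℝ).hasFDerivAt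
      rw [(h1.fun_mul (hh.differentiable one_ne_zero x).hasFDerivAt).fderiv]
      simp [e]
    have hI : Integrable (fun x => x i * fderiv ℝ h x (e i)) :=
      (hp.continuous.mul ((hh.continuous_fderiv one_ne_zero).clm_apply
        continuous_const)).integrable_of_hasCompactSupport (hc.fderiv_apply ℝ (e i)).mul_left
    change ∫ x, fderiv ℝ (fun x => x i * h x) x (e i) = 0 at h0
    simp_rw [hd] at h0
    rw [integral_add hI hi] at h0
    linarith
  have hsum : ∀ x, fderiv ℝ h x x = ∑ i, x i * fderiv ℝ h x (e i) := by
    intro x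
    have : fderiv ℝ h x (∑ i, e.repr x i • e i) = ∑ i, x i * fderiv ℝ h x (e i) := by
      rw [map_sum]
      exact Finset.sum_congr rfl fun i _ => by simp [e]
    rwa [e.sum_repr] at this
  simp_rw [hsum]
  rw [integral_finsetSum]
  · simp [hcoord]
  · intro i _
    exact ((by fun_prop : Continuous fun x : EuclideanSpace ℝ (Fin N) => x i).mul
      ((hh.continuous_fderiv one_ne_zero).clm_apply
        continuous_const)).integrable_of_hasCompactSupport (hc.fderiv_apply ℝ (e i)).mul_left

theorem contDiffAt_norm_rpow {E : Type*} [NormedAddCommGroup E] [InnerProductSpace ℝ E]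
    {n : WithTop ℕ∞} {x : E} (hx : x ≠ 0) (c : ℝ) : ContDiffAt ℝ n (fun x : E => ‖x‖ ^ c) x :=
  (contDiffAt_norm ℝ hx).rpow_const_of_ne (norm_ne_zero_iff.mpr hx)

theorem hasGradientAt_norm_rpow {E : Type*} [NormedAddCommGroup E] [InnerProductSpace ℝ E]
    [CompleteSpace E] {x : E} (hx : x ≠ 0) (c : ℝ) :
    HasGradientAt (fun x : E => ‖x‖ ^ c) ((c * ‖x‖ ^ (c - 2)) • x) x := by
  have hx' : 0 < ‖x‖ := norm_pos_iff.mpr hx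
  -- The power is taken of `‖x‖²`, whose derivative is explicit.
  have h1 : HasFDerivAt (fun x : E => (‖x‖ ^ 2) ^ (c / 2)) _ x :=
    (HasStrictFDerivAt.hasFDerivAt (hasStrictFDerivAt_norm_sq x)).rpow_const
      (Or.inl (by positivity))
  rw [hasGradientAt_iff_hasFDerivAt]
  have he : (fun x : E => (‖x‖ ^ 2) ^ (c / 2)) = fun x : E => ‖x‖ ^ c := by
    ext y
    rw [← Real.rpow_natCast, ← Real.rpow_mul (norm_nonneg _)]
    congr 1
    push_cast
    ring
  rw [he] at h1
  have : (‖x‖ ^ 2) ^ (c / 2 - 1) = ‖x‖ ^ (c - 2) := by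
    rw [← Real.rpow_natCast, ← Real.rpow_mul (norm_nonneg _)]
    congr 1
    push_cast
    ring
  refine h1.congr_fderiv ?_
  ext y
  simp [this]
  ring

/-- The divergence of a power-weighted dilation field, tested against a function supported away
from the origin, has zero integral. -/
theorem integral_norm_rpow_mul_fderiv_self {f : EuclideanSpace ℝ (Fin N) → ℝ}
    (hf : ContDiff ℝ 1 f) (hc : HasCompactSupport f) (h0 : tsupport f ⊆ {0}ᶜ) (c : ℝ) :
    Integrable (fun x => ‖x‖ ^ c * fderiv ℝ f x x + (N + c) * (‖x‖ ^ c * f x)) ∧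
    ∫ x, (‖x‖ ^ c * fderiv ℝ f x x + (N + c) * (‖x‖ ^ c * f x)) = 0 := by
  have hne : ∀ x ∈ tsupport f, x ≠ 0 := fun x hx => h0 hx
  have hh : ContDiff ℝ 1 (fun x => ‖x‖ ^ c * f x) :=
    hf.mul_of_contDiffAt_tsupport fun x hx => contDiffAt_norm_rpow (hne x hx) c
  have hE := integral_fderiv_self_eq hh hc.mul_left
  -- Differentiating the weight radially gives `c ‖x‖^c`, which shifts the divergence from `N` to `N
  -- + c`.
  have hd : ∀ x, fderiv ℝ (fun x => ‖x‖ ^ c * f x) x x =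
      ‖x‖ ^ c * fderiv ℝ f x x + c * (‖x‖ ^ c * f x) := by
    intro x
    rcases eq_or_ne x 0 with rfl | hx
    · have : f 0 = 0 := image_eq_zero_of_notMem_tsupport fun h => hne 0 h rfl
      simp [this]
    · have h1 := (hasGradientAt_norm_rpow hx c).hasFDerivAt
      rw [(h1.fun_mul (hf.differentiable one_ne_zero x).hasFDerivAt).fderiv]
      have : ‖x‖ ^ (c - 2) * ‖x‖ ^ 2 = ‖x‖ ^ c := by
        rw [← Real.rpow_natCast, ← Real.rpow_add (norm_pos_iff.mpr hx)]
        norm_num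
      simp
      rw [← this]
      ring
  simp_rw [hd] at hE
  have hi : Integrable (fun x => ‖x‖ ^ c * f x) :=
    hh.continuous.integrable_of_hasCompactSupport hc.mul_left
  have hi' : Integrable (fun x => ‖x‖ ^ c * fderiv ℝ f x x) := by
    refine integrable_mul_of_continuousAt_tsupport
      ((hf.continuous_fderiv one_ne_zero).clm_apply continuous_id) ?_ ?_
    · exact (hc.fderiv ℝ).mono fun x hx h => hx (by simp [h])
    · intro x hx
      have : x ∈ tsupport f := tsupport_fderiv_subset ℝ (f := f)
        (closure_mono (Function.support_subset_iff'.mpr fun y hy => by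
          simp [Function.notMem_support.mp hy]) hx)
      exact (contDiffAt_norm_rpow (n := 0) (hne x this) c).continuousAt
  refine ⟨hi'.add (hi.const_mul _), ?_⟩
  rw [integral_add hi' (hi.const_mul c), integral_const_mul] at hE
  rw [integral_add hi' (hi.const_mul _), integral_const_mul]
  linarith

end Euler

/-! ### The Hardy form at the origin and its ground state representation. -/

section HardyOrigin

variable {N : ℕ}

/-- The gradient of `u` relative to the ground state `‖x‖ ^ ((2 - N) / 2)` of the Hardy
operator: `‖x‖ ^ ((2 - N) / 2) • ∇ (‖x‖ ^ ((N - 2) / 2) * u)`. -/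
noncomputable def hardyGradient (u : EuclideanSpace ℝ (Fin N) → ℝ)
    (x : EuclideanSpace ℝ (Fin N)) : EuclideanSpace ℝ (Fin N) :=
  gradient u x + (((N : ℝ) - 2) / 2 * (‖x‖ ^ (-2 : ℝ) * u x)) • x

/-- The Hardy quadratic form, with the sharp constant. -/
noncomputable def hardyForm (u : EuclideanSpace ℝ (Fin N) → ℝ) : ℝ :=
  ∫ x, ‖hardyGradient u x‖ ^ 2

theorem hardyForm_nonneg (u : EuclideanSpace ℝ (Fin N) → ℝ) : 0 ≤ hardyForm u :=
  integral_nonneg fun _ => by positivity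

theorem norm_rpow_neg_two_mul_sq {E : Type*} [NormedAddCommGroup E] {x : E} (hx : x ≠ 0) :
    ‖x‖ ^ (-2 : ℝ) * ‖x‖ ^ 2 = 1 := by
  rw [← Real.rpow_natCast, ← Real.rpow_add (norm_pos_iff.mpr hx)]
  norm_num

theorem norm_gradient_eq {E : Type*} [NormedAddCommGroup E] [InnerProductSpace ℝ E]
    [CompleteSpace E] (f : E → ℝ) (x : E) : ‖gradient f x‖ = ‖fderiv ℝ f x‖ := by
  rw [← toDual_gradient, LinearIsometryEquiv.norm_map]

theorem continuous_gradient {E : Type*} [NormedAddCommGroup E] [InnerProductSpace ℝ E]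
    [CompleteSpace E] {f : E → ℝ} (hf : ContDiff ℝ 1 f) : Continuous (gradient f) :=
  (InnerProductSpace.toDual ℝ E).symm.continuous.comp (hf.continuous_fderiv one_ne_zero)

variable {u : EuclideanSpace ℝ (Fin N) → ℝ}

theorem fderiv_sq_apply {E : Type*} [NormedAddCommGroup E] [NormedSpace ℝ E] {u : E → ℝ} {x : E}
    (hu : DifferentiableAt ℝ u x) (v : E) :
    fderiv ℝ (fun x => u x ^ 2) x v = 2 * u x * fderiv ℝ u x v := by
  rw [fderiv_fun_pow 2 hu]
  simp

theorem tsupport_sq_subset {X : Type*} [TopologicalSpace X] (u : X → ℝ) :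
    tsupport (fun x => u x ^ 2) ⊆ tsupport u :=
  closure_mono fun x hx h => hx (by simp [h])

theorem HasCompactSupport.sq {X : Type*} [TopologicalSpace X] {u : X → ℝ}
    (hc : HasCompactSupport u) : HasCompactSupport (fun x => u x ^ 2) :=
  hc.mono fun x hx h => hx (by simp [h])

theorem integrable_hardyGradient_sq (hu : ContDiff ℝ 1 u) (hc : HasCompactSupport u)
    (h0 : tsupport u ⊆ {0}ᶜ) : Integrable (fun x => ‖hardyGradient u x‖ ^ 2) := by
  have h1 : Continuous fun x => ‖x‖ ^ (-2 : ℝ) * u x :=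
    hu.continuous.mul_of_continuousAt_tsupport fun x hx =>
      (contDiffAt_norm_rpow (n := 0) (h0 hx) _).continuousAt
  refine (((continuous_gradient hu).add
    ((continuous_const.mul h1).smul continuous_id)).norm.pow 2).integrable_of_hasCompactSupport ?_
  refine HasCompactSupport.intro hc fun x hx => ?_
  have h2 : u x = 0 := image_eq_zero_of_notMem_tsupport hx
  have h3 : fderiv ℝ u x = 0 := by
    by_contra h
    exact hx (support_fderiv_subset ℝ h)
  simp [gradient, h2, h3]

theorem integrable_rpow_mul_sq (hu : ContDiff ℝ 1 u) (hc : HasCompactSupport u)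
    (h0 : tsupport u ⊆ {0}ᶜ) (c : ℝ) : Integrable (fun x => ‖x‖ ^ c * u x ^ 2) :=
  integrable_mul_of_continuousAt_tsupport (hu.continuous.pow 2) hc.sq fun _ hx =>
      (contDiffAt_norm_rpow (n := 0) (h0 (tsupport_sq_subset u hx)) _).continuousAt

theorem integrable_norm_fderiv_sq {E : Type*} [NormedAddCommGroup E] [NormedSpace ℝ E]
    [MeasurableSpace E] [OpensMeasurableSpace E] {μ : Measure E} [IsFiniteMeasureOnCompacts μ]
    {u : E → ℝ} (hu : ContDiff ℝ 1 u) (hc : HasCompactSupport u) :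
    Integrable (fun x => ‖fderiv ℝ u x‖ ^ 2) μ :=
  ((hu.continuous_fderiv one_ne_zero).norm.pow 2).integrable_of_hasCompactSupport
    (hc.fderiv ℝ).norm.sq

theorem inner_hardyGradient_self {x : EuclideanSpace ℝ (Fin N)} (hx : x ≠ 0) :
    inner ℝ (hardyGradient u x) x = fderiv ℝ u x x + ((N : ℝ) - 2) / 2 * u x := by
  have := norm_rpow_neg_two_mul_sq hx
  rw [hardyGradient, inner_add_left, inner_gradient_left, real_inner_smul_left,
    real_inner_self_eq_norm_sq]
  linear_combination (((N : ℝ) - 2) / 2 * u x) * this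

/-- Expanding `‖hardyGradient u x‖²`, the cross term is `(N-2)/2 · |x|⁻² x·∇(u²)`. The weighted
divergence identity with exponent `-2` turns it into `-(N-2)²/2 · |x|⁻² u²`, and together with the
square term `+(N-2)²/4` this leaves the sharp Hardy constant. -/
theorem hardyForm_eq (hu : ContDiff ℝ 1 u) (hc : HasCompactSupport u)
    (h0 : tsupport u ⊆ {0}ᶜ) :
    hardyForm u = ∫ x, (‖gradient u x‖ ^ 2 - ((N : ℝ) - 2) ^ 2 / (4 * ‖x‖ ^ 2) * u x ^ 2) := by
  obtain ⟨hi, hz⟩ := integral_norm_rpow_mul_fderiv_self (hu.pow 2) hc.sq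
    ((tsupport_sq_subset u).trans h0) (-2)
  have hp : ∀ x, ‖gradient u x‖ ^ 2 - ((N : ℝ) - 2) ^ 2 / (4 * ‖x‖ ^ 2) * u x ^ 2 =
      ‖hardyGradient u x‖ ^ 2 - ((N : ℝ) - 2) / 2 *
        (‖x‖ ^ (-2 : ℝ) * fderiv ℝ (fun x => u x ^ 2) x x +
          (N + (-2)) * (‖x‖ ^ (-2 : ℝ) * u x ^ 2)) := by
    intro x
    rw [fderiv_sq_apply (hu.differentiable one_ne_zero x)]
    rcases eq_or_ne x 0 with rfl | hx
    · have : u 0 = 0 := image_eq_zero_of_notMem_tsupport fun h => h0 h rfl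
      simp [this, hardyGradient]
    · have h1 := norm_rpow_neg_two_mul_sq hx
      have h2 : ((N : ℝ) - 2) ^ 2 / (4 * ‖x‖ ^ 2) = ((N : ℝ) - 2) ^ 2 / 4 * ‖x‖ ^ (-2 : ℝ) := by
        have : ‖x‖ ≠ 0 := norm_ne_zero_iff.mpr hx
        field_simp
        linear_combination (-((N : ℝ) - 2) ^ 2) * h1
      rw [h2, hardyGradient, norm_add_sq_real, real_inner_smul_right, inner_gradient_left,
        norm_smul, mul_pow, Real.norm_eq_abs, sq_abs]
      linear_combination (-(((N : ℝ) - 2) / 2) ^ 2 * u x ^ 2 * ‖x‖ ^ (-2 : ℝ)) * h1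
  simp_rw [hp]
  rw [integral_sub (integrable_hardyGradient_sq hu hc h0) (hi.const_mul _), integral_const_mul,
    hz, hardyForm]
  simp

/-- An improved Hardy inequality: subcritical inverse powers are controlled by the Hardy form. -/
theorem integral_rpow_mul_sq_le_hardyForm (hu : ContDiff ℝ 1 u) (hc : HasCompactSupport u)
    (h0 : tsupport u ⊆ {0}ᶜ) {R : ℝ} (hR : tsupport u ⊆ Metric.closedBall 0 R)
    {a : ℝ} (ha : 0 < a) :
    ∫ x, ‖x‖ ^ (2 * a - 2) * u x ^ 2 ≤ (R ^ (2 * a) / a ^ 2) * hardyForm u := by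
  obtain ⟨hi, hz⟩ := integral_norm_rpow_mul_fderiv_self (hu.pow 2) hc.sq
    ((tsupport_sq_subset u).trans h0) (2 * a - 2)
  -- With `s = ⟪hardyGradient u x, x⟫`, the divergence expression equals `‖x‖^(2a-2) (2us + 2au²)`:
  -- the dimension cancels and a positive multiple of `u²` survives. Half of it pays for the cross
  -- term.
  have hp : ∀ x, a * (‖x‖ ^ (2 * a - 2) * u x ^ 2) ≤
      (‖x‖ ^ (2 * a - 2) * fderiv ℝ (fun x => u x ^ 2) x x +
          (N + (2 * a - 2)) * (‖x‖ ^ (2 * a - 2) * u x ^ 2)) +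
        (R ^ (2 * a) / a) * ‖hardyGradient u x‖ ^ 2 := by
    intro x
    rw [fderiv_sq_apply (hu.differentiable one_ne_zero x)]
    by_cases hx : x ∈ tsupport u
    · have hx0 : x ≠ 0 := h0 hx
      have hx1 : 0 < ‖x‖ := norm_pos_iff.mpr hx0
      have hxR : ‖x‖ ≤ R := by simpa using hR hx
      have h1 := inner_hardyGradient_self (u := u) hx0
      have h2 := abs_real_inner_le_norm (hardyGradient u x) x
      set G := ‖hardyGradient u x‖
      set s := inner ℝ (hardyGradient u x) x
      have h3 : ‖x‖ ^ (2 * a) = ‖x‖ ^ (2 * a - 2) * ‖x‖ ^ 2 := by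
        rw [← Real.rpow_natCast, ← Real.rpow_add hx1]
        norm_num
      have h4 : ‖x‖ ^ (2 * a) ≤ R ^ (2 * a) := by gcongr
      -- Young's inequality, from `(a u + s)² ≥ 0`, followed by Cauchy–Schwarz for `s`.
      have h5 : -(2 * u x * s) ≤ a * u x ^ 2 + (‖x‖ ^ 2 * G ^ 2) / a := by
        have hs : s ^ 2 ≤ ‖x‖ ^ 2 * G ^ 2 := by
          have := sq_le_sq' (by linarith [neg_abs_le s]) ((le_abs_self s).trans h2)
          linarith
        have h6 : 0 ≤ (a * u x + s) ^ 2 / a := by positivity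
        have h7 : (a * u x + s) ^ 2 / a = a * u x ^ 2 + 2 * u x * s + s ^ 2 / a := by
          field_simp
          ring
        have h8 : s ^ 2 / a ≤ (‖x‖ ^ 2 * G ^ 2) / a := by gcongr
        linarith
      have h9 : ‖x‖ ^ (2 * a) / a * G ^ 2 ≤ R ^ (2 * a) / a * G ^ 2 := by gcongr
      have h10 := mul_le_mul_of_nonneg_left h5
        (Real.rpow_nonneg hx1.le (2 * a - 2))
      have h11 : fderiv ℝ u x x = s - ((N : ℝ) - 2) / 2 * u x := by linarith
      rw [h3] at h9
      rw [h11]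
      have e1 : ‖x‖ ^ (2 * a - 2) * ‖x‖ ^ 2 / a * G ^ 2 =
        ‖x‖ ^ (2 * a - 2) * (‖x‖ ^ 2 * G ^ 2 / a) := by ring
      rw [e1] at h9
      linarith
    · have h2 : u x = 0 := image_eq_zero_of_notMem_tsupport hx
      have h3 : gradient u x = 0 := by
        have : fderiv ℝ u x = 0 := by
          by_contra h
          exact hx (support_fderiv_subset ℝ h)
        simp [gradient, this]
      simp [h2, hardyGradient, h3]
  have hG := integrable_hardyGradient_sq hu hc h0
  have hJ := integrable_rpow_mul_sq hu hc h0 (2 * a - 2)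
  have := integral_mono (hJ.const_mul a) (hi.add (hG.const_mul (R ^ (2 * a) / a))) hp
  simp only [Pi.add_apply] at this
  rw [integral_add hi (hG.const_mul _), hz, integral_const_mul, integral_const_mul, zero_add,
    ← hardyForm] at this
  rw [div_mul_eq_mul_div] at this ⊢
  rw [le_div_iff₀ (by positivity)] at this ⊢
  linarith

theorem contDiff_rpow_mul {n : WithTop ℕ∞} (hu : ContDiff ℝ n u) (h0 : tsupport u ⊆ {0}ᶜ)
    (a : ℝ) : ContDiff ℝ n (fun x => ‖x‖ ^ a * u x) :=
  hu.mul_of_contDiffAt_tsupport fun _ hx => contDiffAt_norm_rpow (h0 hx) _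

/-- Multiplication by a positive power of `‖x‖` maps the Hardy form domain into `H¹`. -/
theorem integral_norm_fderiv_rpow_mul_sq_le_hardyForm (hu : ContDiff ℝ 1 u)
    (hc : HasCompactSupport u) (h0 : tsupport u ⊆ {0}ᶜ) {R : ℝ}
    (hR : tsupport u ⊆ Metric.closedBall 0 R) {a : ℝ} (ha : 0 < a) :
    ∫ x, ‖fderiv ℝ (fun x => ‖x‖ ^ a * u x) x‖ ^ 2 ≤
      (2 * R ^ (2 * a) + 2 * (a - ((N : ℝ) - 2) / 2) ^ 2 * (R ^ (2 * a) / a ^ 2)) *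
        hardyForm u := by
  have hw := contDiff_rpow_mul hu h0 a
  have hp : ∀ x, ‖fderiv ℝ (fun x => ‖x‖ ^ a * u x) x‖ ^ 2 ≤
      2 * R ^ (2 * a) * ‖hardyGradient u x‖ ^ 2 +
        2 * (a - ((N : ℝ) - 2) / 2) ^ 2 * (‖x‖ ^ (2 * a - 2) * u x ^ 2) := by
    intro x
    by_cases hx : x ∈ tsupport u
    · have hx0 : x ≠ 0 := h0 hx
      have hx1 : 0 < ‖x‖ := norm_pos_iff.mpr hx0
      have hxR : ‖x‖ ≤ R := by simpa using hR hx
      have h3 : ‖x‖ ^ (2 * a) = ‖x‖ ^ (2 * a - 2) * ‖x‖ ^ 2 := by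
        rw [← Real.rpow_natCast, ← Real.rpow_add hx1]
        norm_num
      have h4 : ‖x‖ ^ (2 * a) ≤ R ^ (2 * a) := by gcongr
      have h5 : (‖x‖ ^ a) ^ 2 = ‖x‖ ^ (2 * a) := by
        rw [← Real.rpow_natCast, ← Real.rpow_mul hx1.le]
        push_cast
        ring_nf
      have h6 : (‖x‖ ^ (a - 2)) = ‖x‖ ^ a * ‖x‖ ^ (-2 : ℝ) := by
        rw [← Real.rpow_add hx1]
        ring_nf
      -- The singular part of the gradient of `‖x‖^a u` is a multiple of `‖x‖^(a-2) u x`, exactly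
      -- what the improved Hardy inequality controls.
      have h7 : gradient (fun x => ‖x‖ ^ a * u x) x = ‖x‖ ^ a • (hardyGradient u x +
          ((a - ((N : ℝ) - 2) / 2) * ‖x‖ ^ (-2 : ℝ) * u x) • x) := by
        have hg := (hasGradientAt_norm_rpow hx0 a).hasFDerivAt.fun_mul
          (hu.differentiable one_ne_zero x).hasGradientAt.hasFDerivAt
        refine HasGradientAt.gradient ?_
        rw [hasGradientAt_iff_hasFDerivAt]
        refine hg.congr_fderiv ?_
        rw [← map_smul, ← map_smul, ← map_add]
        congr 1
        rw [hardyGradient, h6]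
        module
      have h8 := parallelogram_law_with_norm ℝ (hardyGradient u x)
        (((a - ((N : ℝ) - 2) / 2) * ‖x‖ ^ (-2 : ℝ) * u x) • x)
      rw [← norm_gradient_eq, h7, norm_smul, mul_pow, Real.norm_eq_abs, sq_abs, h5]
      have h9 : ‖((a - ((N : ℝ) - 2) / 2) * ‖x‖ ^ (-2 : ℝ) * u x) • x‖ ^ 2 =
          (a - ((N : ℝ) - 2) / 2) ^ 2 * (‖x‖ ^ (-2 : ℝ) * u x ^ 2) := by
        rw [norm_smul, mul_pow, Real.norm_eq_abs, sq_abs]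
        linear_combination ((a - ((N : ℝ) - 2) / 2) ^ 2 * (‖x‖ ^ (-2 : ℝ) * u x ^ 2)) *
          norm_rpow_neg_two_mul_sq hx0
      have h10 : ‖hardyGradient u x + ((a - ((N : ℝ) - 2) / 2) * ‖x‖ ^ (-2 : ℝ) * u x) • x‖ ^ 2 ≤
          2 * (‖hardyGradient u x‖ ^ 2 +
            (a - ((N : ℝ) - 2) / 2) ^ 2 * (‖x‖ ^ (-2 : ℝ) * u x ^ 2)) := by
        rw [← h9]
        nlinarith [sq_nonneg ‖hardyGradient u x -
          ((a - ((N : ℝ) - 2) / 2) * ‖x‖ ^ (-2 : ℝ) * u x) • x‖]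
      have h11 : ‖x‖ ^ (2 * a) * ‖x‖ ^ (-2 : ℝ) = ‖x‖ ^ (2 * a - 2) := by
        rw [← Real.rpow_add hx1]
        ring_nf
      calc _ ≤ ‖x‖ ^ (2 * a) * (2 * (‖hardyGradient u x‖ ^ 2 +
            (a - ((N : ℝ) - 2) / 2) ^ 2 * (‖x‖ ^ (-2 : ℝ) * u x ^ 2))) := by gcongr
        _ = 2 * ‖x‖ ^ (2 * a) * ‖hardyGradient u x‖ ^ 2 +
          2 * (a - ((N : ℝ) - 2) / 2) ^ 2 * (‖x‖ ^ (2 * a - 2) * u x ^ 2) := by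
            rw [← h11]
            ring
        _ ≤ _ := by gcongr
    · have : fderiv ℝ (fun x => ‖x‖ ^ a * u x) x = 0 := by
        by_contra h
        exact hx (tsupport_mul_subset_right (support_fderiv_subset ℝ h))
      have h2 : u x = 0 := image_eq_zero_of_notMem_tsupport hx
      have h3 : gradient u x = 0 := by
        have : fderiv ℝ u x = 0 := by
          by_contra h
          exact hx (support_fderiv_subset ℝ h)
        simp [gradient, this]
      simp [this, h2, hardyGradient, h3]
  have hG := integrable_hardyGradient_sq hu hc h0
  have hJ := integrable_rpow_mul_sq hu hc h0 (2 * a - 2)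
  have h1 := integral_mono (integrable_norm_fderiv_sq hw hc.mul_left)
    ((hG.const_mul _).add (hJ.const_mul _)) hp
  simp only [Pi.add_apply] at h1
  rw [integral_add (hG.const_mul _) (hJ.const_mul _), integral_const_mul, integral_const_mul,
    ← hardyForm] at h1
  have h2 := mul_le_mul_of_nonneg_left (integral_rpow_mul_sq_le_hardyForm hu hc h0 hR ha)
    (by positivity : 0 ≤ 2 * (a - ((N : ℝ) - 2) / 2) ^ 2)
  linarith

end HardyOrigin

/-! ### Hardy's inequality for the distance to the boundary. -/

section HardyBoundary

variable {E : Type*} [NormedAddCommGroup E] [InnerProductSpace ℝ E]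

/-- Hardy's inequality in a fixed direction `ν`: here `δ` is an abstract `C¹` function, positive on
the support of `g`, which decreases at unit rate in the direction `ν`. -/
theorem integral_inv_sq_mul_sq_le [FiniteDimensional ℝ E] [MeasurableSpace E] [BorelSpace E]
    {μ : Measure E} [μ.IsAddHaarMeasure] {g δ : E → ℝ} {ν : E} (hν : ‖ν‖ = 1)
    (hg : ContDiff ℝ 1 g) (hc : HasCompactSupport g) (hδ : ContDiff ℝ 1 δ)
    (hpos : ∀ x ∈ tsupport g, 0 < δ x) (hdir : ∀ x, fderiv ℝ δ x ν = -1) :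
    Integrable (fun x => (δ x ^ 2)⁻¹ * g x ^ 2) μ ∧
    ∫ x, (δ x ^ 2)⁻¹ * g x ^ 2 ∂μ ≤ 4 * ∫ x, ‖fderiv ℝ g x‖ ^ 2 ∂μ := by
  have hne : ∀ x ∈ tsupport (fun x => g x ^ 2), δ x ≠ 0 := fun x hx =>
    (hpos x (tsupport_sq_subset g hx)).ne'
  have hh : ContDiff ℝ 1 (fun x => (δ x)⁻¹ * g x ^ 2) :=
    (hg.pow 2).mul_of_contDiffAt_tsupport fun x hx => hδ.contDiffAt.inv (hne x hx)
  have hI : Integrable (fun x => (δ x ^ 2)⁻¹ * g x ^ 2) μ :=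
    integrable_mul_of_continuousAt_tsupport (hg.continuous.pow 2) hc.sq fun x hx =>
      (hδ.continuous.continuousAt.pow 2).inv₀ (pow_ne_zero 2 (hne x hx))
  refine ⟨hI, ?_⟩
  have hz := integral_fderiv_apply_eq_zero (μ := μ) hh hc.sq.mul_left ν
  have hD : Integrable (fun x => fderiv ℝ (fun x => (δ x)⁻¹ * g x ^ 2) x ν) μ :=
    ((hh.continuous_fderiv one_ne_zero).clm_apply continuous_const).integrable_of_hasCompactSupport
      (hc.sq.mul_left.fderiv_apply ℝ ν)
  have hF := integrable_norm_fderiv_sq (μ := μ) hg hc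
  -- The derivative of `g²/δ` along `ν` is `g²/δ² + 2(g/δ) ∂_ν g`, by the unit rate of decrease.
  -- Completing a square absorbs the cross term, and the derivative integrates to zero.
  have hp : ∀ x, 2⁻¹ * ((δ x ^ 2)⁻¹ * g x ^ 2) ≤
      fderiv ℝ (fun x => (δ x)⁻¹ * g x ^ 2) x ν + 2 * ‖fderiv ℝ g x‖ ^ 2 := by
    intro x
    by_cases hx : x ∈ tsupport g
    · have hδx := hpos x hx
      have h1 : fderiv ℝ (fun x => (δ x)⁻¹ * g x ^ 2) x ν =
          (δ x ^ 2)⁻¹ * g x ^ 2 + 2 * ((δ x)⁻¹ * g x) * fderiv ℝ g x ν := by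
        have hi : HasFDerivAt (fun x => (δ x)⁻¹) _ x :=
          (hasDerivAt_inv hδx.ne').comp_hasFDerivAt x
            (hδ.differentiable one_ne_zero x).hasFDerivAt
        have h2 : HasFDerivAt (fun x => g x ^ 2) (fderiv ℝ (fun x => g x ^ 2) x) x :=
          ((hg.pow 2).differentiable one_ne_zero x).hasFDerivAt
        rw [(hi.fun_mul h2).fderiv]
        simp [fderiv_sq_apply (hg.differentiable one_ne_zero x), hdir]
        ring
      have h2 : (fderiv ℝ g x ν) ^ 2 ≤ ‖fderiv ℝ g x‖ ^ 2 := by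
        have := (fderiv ℝ g x).le_opNorm ν
        rw [hν, mul_one, Real.norm_eq_abs] at this
        exact sq_le_sq' (by linarith [neg_abs_le (fderiv ℝ g x ν)])
          ((le_abs_self _).trans this)
      rw [h1, ← inv_pow]
      nlinarith [sq_nonneg ((δ x)⁻¹ * g x + 2 * fderiv ℝ g x ν)]
    · have h2 : g x = 0 := image_eq_zero_of_notMem_tsupport hx
      have h3 : fderiv ℝ (fun x => (δ x)⁻¹ * g x ^ 2) x = 0 := by
        by_contra h
        exact hx (tsupport_sq_subset g (tsupport_mul_subset_right (support_fderiv_subset ℝ h)))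
      simp [h2, h3]
  have := integral_mono (hI.const_mul _) (hD.add (hF.const_mul _)) hp
  simp only [Pi.add_apply] at this
  rw [integral_add hD (hF.const_mul _), hz, integral_const_mul, integral_const_mul] at this
  linarith

/-- Near a boundary point the distance to the boundary is comparable from below to the vertical
height under the graph. -/
theorem HasC2Boundary.exists_height {Ω : Set E} (hb : HasC2Boundary Ω) (ho : IsOpen Ω)
    [FiniteDimensional ℝ E] {p : E} (hp : p ∈ frontier Ω) :
    ∃ (ν : E) (δ : E → ℝ) (r C : ℝ), ‖ν‖ = 1 ∧ ContDiff ℝ 1 δ ∧ 0 < r ∧ 0 ≤ C ∧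
      (∀ x, fderiv ℝ δ x ν = -1) ∧
      ∀ x ∈ Ω ∩ Metric.ball p r, 0 < δ x ∧ δ x ≤ C * distBoundary Ω x := by
  obtain ⟨ν, a, r, hν, ha, hr, hx⟩ := hb p hp
  have ha1 : ContDiff ℝ 1 a := ha.of_le (by norm_num)
  let P : E →L[ℝ] E := ContinuousLinearMap.id ℝ E - (innerSL ℝ ν).smulRight ν
  have hPx : ∀ x, P x = x - inner ℝ ν x • ν := fun x => by simp [P]
  have hδ : ContDiff ℝ 1 (fun x => a (P x) - innerSL ℝ ν x) :=
    (ha1.comp P.contDiff).sub (innerSL ℝ ν).contDiff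
  obtain ⟨K, t, ht, hK⟩ := (hδ.contDiffAt (x := p)).exists_lipschitzOnWith
  obtain ⟨ρ, hρ, hρt⟩ := Metric.mem_nhds_iff.mp ht
  -- `C` is a local Lipschitz constant of `δ`. The radii are halved because the boundary point `z`
  -- nearest to `x` satisfies `dist z p ≤ 2 dist x p`, so `z` stays in the chart; there `δ z ≤ 0`,
  -- whence `δ x ≤ δ x - δ z ≤ C dist x z`.
  refine ⟨ν, fun x => a (P x) - innerSL ℝ ν x, min (r / 2) (ρ / 2), K, hν, hδ, by positivity,
    K.2, ?_, ?_⟩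
  · intro x
    have hPν : P ν = 0 := by
      rw [hPx, real_inner_self_eq_norm_sq, hν]
      simp
    have h1 := ((ha1.differentiable one_ne_zero (P x)).hasFDerivAt.comp x P.hasFDerivAt).sub
      (innerSL ℝ ν).hasFDerivAt
    have h2 : fderiv ℝ (fun x => a (P x) - innerSL ℝ ν x) x = _ := h1.fderiv
    rw [h2]
    simp [hPν, hν]
  · rintro x ⟨hxΩ, hxp⟩
    rw [Metric.mem_ball] at hxp
    have hxr : x ∈ Metric.ball p r := by
      rw [Metric.mem_ball]
      linarith [min_le_left (r / 2) (ρ / 2)]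
    have hpos : 0 < a (P x) - innerSL ℝ ν x := by
      have := (hx x hxr).mp hxΩ
      rw [hPx]
      simpa using this
    refine ⟨hpos, ?_⟩
    obtain ⟨z, hz, hzx⟩ := isClosed_frontier.exists_infDist_eq_dist ⟨p, hp⟩ x
    have hzle : dist x z ≤ dist x p := hzx ▸ Metric.infDist_le_dist_of_mem hp
    have hzp : dist z p ≤ dist x z + dist x p := by
      rw [dist_comm x z]
      exact dist_triangle z x p
    have hzr : z ∈ Metric.ball p r := by
      rw [Metric.mem_ball]
      linarith [min_le_left (r / 2) (ρ / 2)]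
    have hzt : z ∈ t := hρt (by
      rw [Metric.mem_ball]
      linarith [min_le_right (r / 2) (ρ / 2)])
    have hxt : x ∈ t := hρt (by
      rw [Metric.mem_ball]
      linarith [min_le_right (r / 2) (ρ / 2)])
    have hzΩ : z ∉ Ω := fun h => by
      rw [ho.frontier_eq] at hz
      exact hz.2 h
    have hz0 : a (P z) - innerSL ℝ ν z ≤ 0 := by
      have := mt (hx z hzr).mpr hzΩ
      rw [hPx]
      simpa using this
    have hL := hK.dist_le_mul x hxt z hzt
    rw [Real.dist_eq, ← hzx] at hL
    exact (by linarith [le_abs_self (a (P x) - innerSL ℝ ν x - (a (P z) - innerSL ℝ ν z))] :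
      a (P x) - innerSL ℝ ν x ≤ a (P x) - innerSL ℝ ν x - (a (P z) - innerSL ℝ ν z)).trans
        ((le_abs_self _).trans hL)

theorem continuous_distBoundary {E : Type*} [NormedAddCommGroup E] (Ω : Set E) : Continuous (distBoundary Ω) :=
  Metric.continuous_infDist_pt _

theorem distBoundary_pos {E : Type*} [NormedAddCommGroup E] {Ω : Set E} (ho : IsOpen Ω) (hne : (frontier Ω).Nonempty) {x : E}
    (hx : x ∈ Ω) : 0 < distBoundary Ω x :=
  (isClosed_frontier.notMem_iff_infDist_pos hne).mp fun h => by
    rw [ho.frontier_eq] at h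
    exact h.2 hx

theorem norm_fderiv_mul_sq_le {χ w : E → ℝ} {x : E} {M : ℝ} (hχ : DifferentiableAt ℝ χ x)
    (hw : DifferentiableAt ℝ w x) (h1 : |χ x| ≤ 1) (hM : ‖fderiv ℝ χ x‖ ≤ M) :
    ‖fderiv ℝ (fun x => χ x * w x) x‖ ^ 2 ≤ 2 * ‖fderiv ℝ w x‖ ^ 2 + 2 * M ^ 2 * w x ^ 2 := by
  rw [fderiv_fun_mul hχ hw]
  have h2 : ‖χ x • fderiv ℝ w x + w x • fderiv ℝ χ x‖ ≤ ‖fderiv ℝ w x‖ + |w x| * M := by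
    refine (norm_add_le _ _).trans (add_le_add ?_ ?_)
    · rw [norm_smul, Real.norm_eq_abs]
      exact mul_le_of_le_one_left (norm_nonneg _) h1
    · rw [norm_smul, Real.norm_eq_abs]
      gcongr
  calc _ ≤ (‖fderiv ℝ w x‖ + |w x| * M) ^ 2 := by gcongr
    _ ≤ 2 * ‖fderiv ℝ w x‖ ^ 2 + 2 * M ^ 2 * |w x| ^ 2 := by
      nlinarith [sq_nonneg (‖fderiv ℝ w x‖ - |w x| * M)]
    _ = _ := by rw [sq_abs]

theorem integrable_inv_distBoundary_sq_mul_sq {E : Type*} [NormedAddCommGroup E]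
    [MeasurableSpace E] [OpensMeasurableSpace E] {μ : Measure E} [IsFiniteMeasureOnCompacts μ]
    {Ω : Set E} (ho : IsOpen Ω) (hne : (frontier Ω).Nonempty)
    {w : E → ℝ} (hw : Continuous w) (hc : HasCompactSupport w) (hs : tsupport w ⊆ Ω) :
    Integrable (fun x => (distBoundary Ω x ^ 2)⁻¹ * w x ^ 2) μ :=
  integrable_mul_of_continuousAt_tsupport (hw.pow 2) hc.sq fun _ hx =>
    ((continuous_distBoundary Ω).continuousAt.pow 2).inv₀
      (pow_ne_zero 2 (distBoundary_pos ho hne (hs (tsupport_sq_subset w hx))).ne')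

variable [FiniteDimensional ℝ E] [MeasurableSpace E] [BorelSpace E]
    {μ : Measure E} [μ.IsAddHaarMeasure] {Ω : Set E}

/-- Hardy's inequality localized near a boundary point. -/
theorem HasC2Boundary.exists_local_hardy (hb : HasC2Boundary Ω) (ho : IsOpen Ω) {p : E}
    (hp : p ∈ frontier Ω) :
    ∃ (φ : E → ℝ) (C : ℝ), Continuous φ ∧ (∀ x, 0 ≤ φ x) ∧ (∀ᶠ x in nhds p, 1 ≤ φ x) ∧ 0 ≤ C ∧
      ∀ w : E → ℝ, ContDiff ℝ 1 w → HasCompactSupport w → tsupport w ⊆ Ω →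
        ∫ x, φ x * ((distBoundary Ω x ^ 2)⁻¹ * w x ^ 2) ∂μ ≤
          C * (∫ x, ‖fderiv ℝ w x‖ ^ 2 ∂μ + ∫ x, w x ^ 2 ∂μ) := by
  obtain ⟨ν, δ, r, C, hν, hδ, hr, hC, hdir, hx⟩ := hb.exists_height ho hp
  let χ : ContDiffBump p := ⟨r / 3, r / 2, by positivity, by linarith⟩
  have hχ : ContDiff ℝ 1 χ := χ.contDiff
  have hχs : tsupport χ ⊆ Metric.ball p r := by
    rw [χ.tsupport_eq]
    exact Metric.closedBall_subset_ball (by change r / 2 < r; linarith)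
  have hχ1 : ∀ x, |χ x| ≤ 1 := fun x => by rw [abs_of_nonneg χ.nonneg]; exact χ.le_one
  obtain ⟨M, hM⟩ := (hχ.continuous_fderiv one_ne_zero).bounded_above_of_compact_support
    (χ.hasCompactSupport.fderiv ℝ)
  refine ⟨fun x => χ x ^ 2, C ^ 2 * (4 * (2 + 2 * M ^ 2)), hχ.continuous.pow 2,
    fun x => by positivity, ?_, by positivity, ?_⟩
  · filter_upwards [χ.eventuallyEq_one] with x hx
    simp [hx]
  intro w hw hc hs
  have hg : ContDiff ℝ 1 (fun x => χ x * w x) := hχ.mul hw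
  have hgs : tsupport (fun x => χ x * w x) ⊆ Ω ∩ Metric.ball p r :=
    Set.subset_inter (tsupport_mul_subset_right.trans hs) (tsupport_mul_subset_left.trans hχs)
  obtain ⟨hI, hle⟩ := integral_inv_sq_mul_sq_le (μ := μ) hν hg hc.mul_left hδ
    (fun x h => (hx x (hgs h)).1) hdir
  have hne : (frontier Ω).Nonempty := ⟨p, hp⟩
  have hId := integrable_inv_distBoundary_sq_mul_sq (μ := μ) ho hne hg.continuous hc.mul_left
    (hgs.trans Set.inter_subset_left)
  have h1 : ∫ x, (distBoundary Ω x ^ 2)⁻¹ * (χ x * w x) ^ 2 ∂μ ≤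
      C ^ 2 * ∫ x, (δ x ^ 2)⁻¹ * (χ x * w x) ^ 2 ∂μ := by
    rw [← integral_const_mul]
    refine integral_mono hId (hI.const_mul _) fun x => ?_
    by_cases h : x ∈ tsupport (fun x => χ x * w x)
    · obtain ⟨h2, h3⟩ := hx x (hgs h)
      have h4 := distBoundary_pos ho hne (hgs h).1
      have h5 : (distBoundary Ω x ^ 2)⁻¹ ≤ C ^ 2 * (δ x ^ 2)⁻¹ := by
        rw [← div_eq_mul_inv, le_div_iff₀ (by positivity), inv_mul_le_iff₀ (by positivity),
          ← mul_pow, mul_comm]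
        gcongr
      simp only
      rw [← mul_assoc]
      gcongr
    · have : χ x * w x = 0 :=
        image_eq_zero_of_notMem_tsupport (f := fun x => χ x * w x) h
      simp [this]
  have hF := integrable_norm_fderiv_sq (μ := μ) hw hc
  have hW : Integrable (fun x => w x ^ 2) μ :=
    (hw.continuous.pow 2).integrable_of_hasCompactSupport hc.sq
  have h2 : ∫ x, ‖fderiv ℝ (fun x => χ x * w x) x‖ ^ 2 ∂μ ≤
      2 * ∫ x, ‖fderiv ℝ w x‖ ^ 2 ∂μ + 2 * M ^ 2 * ∫ x, w x ^ 2 ∂μ := by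
    rw [← integral_const_mul, ← integral_const_mul,
      ← integral_add (hF.const_mul _) (hW.const_mul _)]
    exact integral_mono (integrable_norm_fderiv_sq hg hc.mul_left)
      ((hF.const_mul _).add (hW.const_mul _)) fun x =>
        norm_fderiv_mul_sq_le (hχ.differentiable one_ne_zero x)
          (hw.differentiable one_ne_zero x) (hχ1 x) (hM x)
  have h3 : 0 ≤ ∫ x, ‖fderiv ℝ w x‖ ^ 2 ∂μ := integral_nonneg fun _ => by positivity
  have h4 : 0 ≤ ∫ x, w x ^ 2 ∂μ := integral_nonneg fun _ => by positivity
  have h5 : ∀ x, χ x ^ 2 * ((distBoundary Ω x ^ 2)⁻¹ * w x ^ 2) =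
      (distBoundary Ω x ^ 2)⁻¹ * (χ x * w x) ^ 2 := fun x => by ring
  simp_rw [h5]
  calc _ ≤ C ^ 2 * (4 * (2 * ∫ x, ‖fderiv ℝ w x‖ ^ 2 ∂μ + 2 * M ^ 2 * ∫ x, w x ^ 2 ∂μ)) :=
        h1.trans (by gcongr; exact hle.trans (by gcongr))
    _ ≤ C ^ 2 * (4 * ((2 + 2 * M ^ 2) * (∫ x, ‖fderiv ℝ w x‖ ^ 2 ∂μ + ∫ x, w x ^ 2 ∂μ))) := by
        gcongr
        nlinarith [mul_nonneg (sq_nonneg M) h3]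
    _ = _ := by ring

/-- **Hardy's inequality** for the distance to the boundary of a bounded `C²` open set. -/
theorem HasC2Boundary.exists_hardy (hb : HasC2Boundary Ω) (ho : IsOpen Ω)
    (hB : Bornology.IsBounded Ω) (hne : (frontier Ω).Nonempty) :
    ∃ C : ℝ, 0 ≤ C ∧
      ∀ w : E → ℝ, ContDiff ℝ 1 w → HasCompactSupport w → tsupport w ⊆ Ω →
        ∫ x, (distBoundary Ω x ^ 2)⁻¹ * w x ^ 2 ∂μ ≤
          C * (∫ x, ‖fderiv ℝ w x‖ ^ 2 ∂μ + ∫ x, w x ^ 2 ∂μ) := by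
  have hcl : IsCompact (closure Ω) := hB.isCompact_closure
  have hfr : IsCompact (frontier Ω) := hcl.of_isClosed_subset isClosed_frontier
    frontier_subset_closure
  have hint {φ w : E → ℝ} (hφ : Continuous φ) (hw : ContDiff ℝ 1 w) (hc : HasCompactSupport w)
      (hs : tsupport w ⊆ Ω) :
      Integrable (fun x => φ x * ((distBoundary Ω x ^ 2)⁻¹ * w x ^ 2)) μ := by
    have := integrable_mul_of_continuousAt_tsupport (μ := μ)
      (φ := fun x => φ x * (distBoundary Ω x ^ 2)⁻¹) (hw.continuous.pow 2) hc.sq fun _ hx =>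
        hφ.continuousAt.mul (((continuous_distBoundary Ω).continuousAt.pow 2).inv₀
          (pow_ne_zero 2 (distBoundary_pos ho hne (hs (tsupport_sq_subset w hx))).ne'))
    simpa only [mul_assoc, Pi.pow_apply] using this
  have key : ∃ (φ : E → ℝ) (C : ℝ), Continuous φ ∧ (∀ x, 0 ≤ φ x) ∧
      (∀ x ∈ frontier Ω, 1 ≤ φ x) ∧ 0 ≤ C ∧
      ∀ w : E → ℝ, ContDiff ℝ 1 w → HasCompactSupport w → tsupport w ⊆ Ω →
        ∫ x, φ x * ((distBoundary Ω x ^ 2)⁻¹ * w x ^ 2) ∂μ ≤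
          C * (∫ x, ‖fderiv ℝ w x‖ ^ 2 ∂μ + ∫ x, w x ^ 2 ∂μ) := by
    -- The property passes to subsets and to unions (add the weights `φ`), so compactness reduces it
    -- to the local inequality without a partition of unity.
    refine hfr.induction_on (p := fun s => ∃ (φ : E → ℝ) (C : ℝ), Continuous φ ∧
      (∀ x, 0 ≤ φ x) ∧ (∀ x ∈ s, 1 ≤ φ x) ∧ 0 ≤ C ∧
      ∀ w : E → ℝ, ContDiff ℝ 1 w → HasCompactSupport w → tsupport w ⊆ Ω →
        ∫ x, φ x * ((distBoundary Ω x ^ 2)⁻¹ * w x ^ 2) ∂μ ≤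
          C * (∫ x, ‖fderiv ℝ w x‖ ^ 2 ∂μ + ∫ x, w x ^ 2 ∂μ)) ?_ ?_ ?_ ?_
    · exact ⟨fun _ => 0, 0, continuous_const, by simp, by simp, le_rfl, by simp⟩
    · rintro s t hst ⟨φ, C, h1, h2, h3, h4⟩
      exact ⟨φ, C, h1, h2, fun x hx => h3 x (hst hx), h4⟩
    · rintro s t ⟨φ, C, h1, h2, h3, h4, h5⟩ ⟨φ', C', h1', h2', h3', h4', h5'⟩
      refine ⟨fun x => φ x + φ' x, C + C', h1.add h1', fun x => add_nonneg (h2 x) (h2' x), ?_,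
        add_nonneg h4 h4', ?_⟩
      · rintro x (hx | hx)
        · linarith [h3 x hx, h2' x]
        · linarith [h3' x hx, h2 x]
      · intro w hw hc hs
        simp_rw [add_mul]
        rw [integral_add (hint h1 hw hc hs) (hint h1' hw hc hs)]
        exact add_le_add (h5 w hw hc hs) (h5' w hw hc hs)
    · intro p hp
      obtain ⟨φ, C, h1, h2, h3, h4⟩ := hb.exists_local_hardy (μ := μ) ho hp
      exact ⟨{x | 1 ≤ φ x}, mem_nhdsWithin_of_mem_nhds h3, φ, C, h1, h2, fun _ hx => hx, h4⟩
  obtain ⟨φ, C, hφ, hφ0, hφ1, hC, hH⟩ := key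
  -- Where `φ > 1/2` the weighted inequality suffices, at the cost of a factor `2`. The rest of
  -- `closure Ω` is compact and misses the boundary, so the distance is at least some `c > 0` there.
  have hK : IsCompact (closure Ω ∩ {x | φ x ≤ 1 / 2}) :=
    hcl.inter_right (isClosed_le hφ continuous_const)
  obtain ⟨c, hc0, hcK⟩ := hK.exists_forall_le' (continuous_distBoundary Ω).continuousOn
    (a := 0) fun x hx => (isClosed_frontier.notMem_iff_infDist_pos hne).mp fun h => by
      have h1 := hφ1 x h
      have h2 : φ x ≤ 1 / 2 := hx.2
      linarith
  refine ⟨2 * C + (c ^ 2)⁻¹, by positivity, fun w hw hc hs => ?_⟩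
  have hW : Integrable (fun x => w x ^ 2) μ :=
    (hw.continuous.pow 2).integrable_of_hasCompactSupport hc.sq
  have h1 : ∫ x, (distBoundary Ω x ^ 2)⁻¹ * w x ^ 2 ∂μ ≤
      2 * ∫ x, φ x * ((distBoundary Ω x ^ 2)⁻¹ * w x ^ 2) ∂μ + (c ^ 2)⁻¹ * ∫ x, w x ^ 2 ∂μ := by
    rw [← integral_const_mul, ← integral_const_mul,
      ← integral_add ((hint hφ hw hc hs).const_mul _) (hW.const_mul _)]
    refine integral_mono (integrable_inv_distBoundary_sq_mul_sq ho hne hw.continuous hc hs)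
      (((hint hφ hw hc hs).const_mul _).add (hW.const_mul _)) fun x => ?_
    simp only
    have hq : 0 ≤ (distBoundary Ω x ^ 2)⁻¹ * w x ^ 2 := by positivity
    rcases le_or_gt (φ x) (1 / 2) with h | h
    · by_cases hx : x ∈ tsupport w
      · have h2 := hcK x ⟨subset_closure (hs hx), h⟩
        have h3 : (distBoundary Ω x ^ 2)⁻¹ * w x ^ 2 ≤ (c ^ 2)⁻¹ * w x ^ 2 := by gcongr
        have h4 := mul_nonneg (hφ0 x) hq
        linarith
      · have : w x = 0 := image_eq_zero_of_notMem_tsupport hx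
        simp [this]
    · have h3 : 0 ≤ (c ^ 2)⁻¹ * w x ^ 2 := by positivity
      nlinarith
  have h2 := hH w hw hc hs
  have h3 : 0 ≤ ∫ x, ‖fderiv ℝ w x‖ ^ 2 ∂μ := integral_nonneg fun _ => by positivity
  have h4 := mul_nonneg (by positivity : 0 ≤ (c ^ 2)⁻¹) h3
  linarith

end HardyBoundary

/-! ### Sobolev inequality, form bounds and the choice of parameters. -/

section LogHardySobolev

variable {N : ℕ}

/-- The Sobolev inequality for the critical exponent `2N / (N - 2)`, in integral form. -/
theorem exists_sobolev (hN : 3 ≤ N) : ∃ C : ℝ, 0 ≤ C ∧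
    ∀ w : EuclideanSpace ℝ (Fin N) → ℝ, ContDiff ℝ 1 w → HasCompactSupport w →
      ∫ x, |w x| ^ (2 * (N : ℝ) / (N - 2)) ≤
        (C * ∫ x, ‖fderiv ℝ w x‖ ^ 2) ^ ((N : ℝ) / (N - 2)) := by
  have hN' : (3 : ℝ) ≤ N := by exact_mod_cast hN
  have hN2 : (0 : ℝ) < N - 2 := by linarith
  let p : NNReal := ⟨2 * (N : ℝ) / (N - 2), by positivity⟩
  have hp0 : (p : ℝ) = 2 * (N : ℝ) / (N - 2) := rfl
  have hppos : (0 : ℝ) < p := by rw [hp0]; positivity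
  let K : NNReal := SNormLESNormFDerivOfEqConst ℝ
    (volume : Measure (EuclideanSpace ℝ (Fin N))) ((2 : NNReal) : ℝ)
  refine ⟨(K : ℝ) ^ 2, by positivity, fun w hw hc => ?_⟩
  have h := eLpNorm_le_eLpNorm_fderiv_of_eq (F := ℝ)
    (volume : Measure (EuclideanSpace ℝ (Fin N))) hw hc (p := 2) (p' := p) (by norm_num)
    (by simp; omega) (by
      rw [hp0]
      simp only [finrank_euclideanSpace, Fintype.card_fin]
      push_cast
      field_simp)
  have hm1 : MemLp w p := hw.continuous.memLp_of_hasCompactSupport hc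
  have hm2 : MemLp (fderiv ℝ w) (2 : NNReal) :=
    (hw.continuous_fderiv one_ne_zero).memLp_of_hasCompactSupport (hc.fderiv ℝ)
  rw [hm1.eLpNorm_eq_integral_rpow_norm (by
      simpa using (NNReal.coe_pos.mp hppos).ne') ENNReal.coe_ne_top,
    hm2.eLpNorm_eq_integral_rpow_norm (by simp) ENNReal.coe_ne_top,
    ← ENNReal.ofReal_coe_nnreal (p := SNormLESNormFDerivOfEqConst ℝ _ _),
    ← ENNReal.ofReal_mul (by positivity),
    ENNReal.ofReal_le_ofReal_iff (by positivity)] at h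
  simp only [ENNReal.coe_toReal, NNReal.coe_ofNat, Real.rpow_ofNat, Real.norm_eq_abs] at h
  change _ ≤ (K : ℝ) * _ at h
  rw [hp0] at h
  set I := ∫ x, |w x| ^ (2 * (N : ℝ) / (N - 2))
  set J := ∫ x, ‖fderiv ℝ w x‖ ^ 2
  have hI : 0 ≤ I := integral_nonneg fun _ => by positivity
  have hJ : 0 ≤ J := integral_nonneg fun _ => by positivity
  -- Raising the norm inequality to the power `2N/(N-2)` turns `K J^(1/2)` into `(K² J)^(N/(N-2))`.
  have h2 := Real.rpow_le_rpow (by positivity) h (by positivity : 0 ≤ 2 * (N : ℝ) / (N - 2))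
  rw [Real.rpow_inv_rpow hI (by positivity)] at h2
  refine h2.trans_eq ?_
  have e1 : 2 * (N : ℝ) / (N - 2) = 2 * ((N : ℝ) / (N - 2)) := by ring
  rw [e1, Real.rpow_mul (by positivity)]
  congr 1
  rw [Real.rpow_ofNat, mul_pow, ← Real.rpow_natCast (J ^ _), ← Real.rpow_mul hJ]
  norm_num

/-- The consequences of the form bounds at the origin and at the boundary that enter the
logarithmic inequality. -/
theorem IsC2BoundedDomain.exists_hardyForm_bounds (hN : 3 ≤ N)
    {Ω : Set (EuclideanSpace ℝ (Fin N))} (hΩ : IsC2BoundedDomain Ω)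
    (h0 : (0 : EuclideanSpace ℝ (Fin N)) ∈ Ω) (hne : (frontier Ω).Nonempty) :
    ∃ C : ℝ, 0 < C ∧ ∀ u : EuclideanSpace ℝ (Fin N) → ℝ, IsTestFunctionOn (Ω \ {0}) u →
      ∫ x, u x ^ 2 ≤ C * hardyForm u ∧
      ∫ x, (distBoundary Ω x ^ 2)⁻¹ * u x ^ 2 ≤ C * hardyForm u ∧
      ∫ x, |‖x‖ ^ (((N : ℝ) - 2) / N) * u x| ^ (2 * (N : ℝ) / (N - 2)) ≤
        (C * hardyForm u) ^ ((N : ℝ) / (N - 2)) := by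
  have hN' : (3 : ℝ) ≤ N := by exact_mod_cast hN
  have hN2 : (0 : ℝ) < N - 2 := by linarith
  obtain ⟨R', hR'⟩ := hΩ.isBounded.subset_closedBall 0
  set R := max R' 1
  have hR : Ω ⊆ Metric.closedBall 0 R :=
    hR'.trans (Metric.closedBall_subset_closedBall (le_max_left _ _))
  have hR1 : 1 ≤ R := le_max_right _ _
  obtain ⟨CS, hCS, hS⟩ := exists_sobolev hN
  obtain ⟨CH, hCH, hH⟩ := hΩ.hasC2Boundary.exists_hardy (μ := volume) hΩ.isOpen hΩ.isBounded hne
  have hd0 : 0 < distBoundary Ω 0 := distBoundary_pos hΩ.isOpen hne h0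
  obtain ⟨ρ, hρ, hρd⟩ := Metric.eventually_nhds_iff_ball.mp
    ((continuous_distBoundary Ω).continuousAt.eventually (lt_mem_nhds (half_lt_self hd0)))
  set c := distBoundary Ω 0 / 2
  have hc : 0 < c := half_pos hd0
  -- This exponent makes `(‖x‖^a)^(2N/(N-2)) = ‖x‖²`, the weight occurring in `X`.
  set a := ((N : ℝ) - 2) / N
  have ha : 0 < a := by positivity
  have ha1 : a ≤ 1 := by
    rw [div_le_one (by positivity)]
    linarith
  set C1 := R ^ (2 * a) / a ^ 2
  have hC1 : 0 ≤ C1 := by positivity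
  set C2 := 2 * R ^ (2 * a) + 2 * (a - ((N : ℝ) - 2) / 2) ^ 2 * C1
  have hC2 : 0 ≤ C2 := by positivity
  set D1 := R ^ (2 - 2 * a) * C1
  set D2 := (c ^ 2)⁻¹ * D1 + ρ ^ (-(2 * a)) * (CH * (C2 + R ^ 2 * C1))
  have hD1 : 0 ≤ D1 := by positivity
  have hD2 : 0 ≤ D2 := by positivity
  have hD3 : 0 ≤ CS * C2 := by positivity
  refine ⟨D1 + D2 + CS * C2 + 1, by positivity, ?_⟩
  rintro u ⟨husm, huc, hus⟩
  have hu : ContDiff ℝ 1 u := husm.of_le (by norm_cast)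
  have huΩ : tsupport u ⊆ Ω := hus.trans Set.sdiff_subset
  have hu0 : tsupport u ⊆ {0}ᶜ := fun x hx => (hus hx).2
  have huR := huΩ.trans hR
  have hQ := hardyForm_nonneg u
  have hJ := integral_rpow_mul_sq_le_hardyForm hu huc hu0 huR ha
  have hF := integral_norm_fderiv_rpow_mul_sq_le_hardyForm hu huc hu0 huR ha
  have hw : ContDiff ℝ 1 (fun x => ‖x‖ ^ a * u x) := contDiff_rpow_mul hu hu0 a
  have hwc : HasCompactSupport (fun x => ‖x‖ ^ a * u x) := huc.mul_left
  have hws : tsupport (fun x => ‖x‖ ^ a * u x) ⊆ Ω := tsupport_mul_subset_right.trans huΩ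
  have hIu : Integrable (fun x => u x ^ 2) :=
    (hu.continuous.pow 2).integrable_of_hasCompactSupport huc.sq
  have hIw : Integrable (fun x => (‖x‖ ^ a * u x) ^ 2) :=
    (hw.continuous.pow 2).integrable_of_hasCompactSupport hwc.sq
  have hIJ := integrable_rpow_mul_sq hu huc hu0 (2 * a - 2)
  have hI1 : ∫ x, u x ^ 2 ≤ D1 * hardyForm u := by
    have : ∫ x, u x ^ 2 ≤ R ^ (2 - 2 * a) * ∫ x, ‖x‖ ^ (2 * a - 2) * u x ^ 2 := by
      rw [← integral_const_mul]
      refine integral_mono hIu (hIJ.const_mul _) fun x => ?_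
      by_cases hx : x ∈ tsupport u
      · have hx1 : 0 < ‖x‖ := norm_pos_iff.mpr (hu0 hx)
        have hxR : ‖x‖ ≤ R := by simpa using huR hx
        calc u x ^ 2 = ‖x‖ ^ (2 - 2 * a) * (‖x‖ ^ (2 * a - 2) * u x ^ 2) := by
              rw [← mul_assoc, ← Real.rpow_add hx1]
              simp
          _ ≤ R ^ (2 - 2 * a) * (‖x‖ ^ (2 * a - 2) * u x ^ 2) := by
              gcongr
              linarith
      · simp [image_eq_zero_of_notMem_tsupport hx]
    refine this.trans ?_
    rw [mul_assoc]
    gcongr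
  have hI2 : ∫ x, (‖x‖ ^ a * u x) ^ 2 ≤ R ^ 2 * C1 * hardyForm u := by
    have : ∫ x, (‖x‖ ^ a * u x) ^ 2 ≤ R ^ 2 * ∫ x, ‖x‖ ^ (2 * a - 2) * u x ^ 2 := by
      rw [← integral_const_mul]
      refine integral_mono hIw (hIJ.const_mul _) fun x => ?_
      by_cases hx : x ∈ tsupport u
      · have hx1 : 0 < ‖x‖ := norm_pos_iff.mpr (hu0 hx)
        have hxR : ‖x‖ ≤ R := by simpa using huR hx
        calc (‖x‖ ^ a * u x) ^ 2 = ‖x‖ ^ 2 * (‖x‖ ^ (2 * a - 2) * u x ^ 2) := by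
              rw [← mul_assoc, ← Real.rpow_natCast ‖x‖, ← Real.rpow_add hx1, mul_pow,
                ← Real.rpow_natCast (‖x‖ ^ a), ← Real.rpow_mul hx1.le]
              push_cast
              ring_nf
          _ ≤ R ^ 2 * (‖x‖ ^ (2 * a - 2) * u x ^ 2) := by gcongr
      · simp [image_eq_zero_of_notMem_tsupport hx]
    refine this.trans ?_
    rw [mul_assoc]
    gcongr
  -- Inside the ball of radius `ρ` the distance exceeds `c`; outside it `u² ≤ ρ^(-2a) w²`, and the
  -- boundary Hardy inequality applies to `w = ‖x‖^a u`.
  have hI3 : ∫ x, (distBoundary Ω x ^ 2)⁻¹ * u x ^ 2 ≤ D2 * hardyForm u := by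
    have hIdw := integrable_inv_distBoundary_sq_mul_sq (μ := volume) hΩ.isOpen hne hw.continuous
      hwc hws
    have : ∫ x, (distBoundary Ω x ^ 2)⁻¹ * u x ^ 2 ≤ (c ^ 2)⁻¹ * (∫ x, u x ^ 2) +
        ρ ^ (-(2 * a)) * ∫ x, (distBoundary Ω x ^ 2)⁻¹ * (‖x‖ ^ a * u x) ^ 2 := by
      rw [← integral_const_mul, ← integral_const_mul,
        ← integral_add (hIu.const_mul _) (hIdw.const_mul _)]
      refine integral_mono (integrable_inv_distBoundary_sq_mul_sq hΩ.isOpen hne hu.continuous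
        huc huΩ) ((hIu.const_mul _).add (hIdw.const_mul _)) fun x => ?_
      simp only
      have p1 : 0 ≤ (c ^ 2)⁻¹ * u x ^ 2 := by positivity
      have p2 : 0 ≤ ρ ^ (-(2 * a)) * ((distBoundary Ω x ^ 2)⁻¹ * (‖x‖ ^ a * u x) ^ 2) := by
        positivity
      rcases lt_or_ge ‖x‖ ρ with hx | hx
      · have h1 := hρd x (by simpa using hx)
        have : (distBoundary Ω x ^ 2)⁻¹ * u x ^ 2 ≤ (c ^ 2)⁻¹ * u x ^ 2 := by gcongr
        linarith
      · have hx1 : 0 < ‖x‖ := hρ.trans_le hx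
        have h1 : 1 ≤ ρ ^ (-(2 * a)) * (‖x‖ ^ a) ^ 2 := by
          rw [Real.rpow_neg hρ.le, ← div_eq_inv_mul, one_le_div (by positivity), mul_comm 2 a,
            Real.rpow_mul hρ.le, Real.rpow_ofNat]
          gcongr
        have : (distBoundary Ω x ^ 2)⁻¹ * u x ^ 2 ≤
            ρ ^ (-(2 * a)) * ((distBoundary Ω x ^ 2)⁻¹ * (‖x‖ ^ a * u x) ^ 2) := by
          calc _ ≤ (ρ ^ (-(2 * a)) * (‖x‖ ^ a) ^ 2) * ((distBoundary Ω x ^ 2)⁻¹ * u x ^ 2) :=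
                le_mul_of_one_le_left (by positivity) h1
            _ = _ := by ring
        linarith
    have h2 := hH _ hw hwc hws
    calc _ ≤ (c ^ 2)⁻¹ * (D1 * hardyForm u) +
          ρ ^ (-(2 * a)) * (CH * (C2 * hardyForm u + R ^ 2 * C1 * hardyForm u)) := by
            refine this.trans ?_
            gcongr
            refine h2.trans ?_
            gcongr
      _ = D2 * hardyForm u := by ring
  refine ⟨hI1.trans ?_, hI3.trans ?_, (hS _ hw hwc).trans ?_⟩
  · gcongr
    linarith
  · gcongr
    linarith
  · have h1 : CS * ∫ x, ‖fderiv ℝ (fun x => ‖x‖ ^ a * u x) x‖ ^ 2 ≤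
        CS * C2 * hardyForm u := by
      rw [mul_assoc]
      gcongr
    have h2 : 0 ≤ ∫ x, ‖fderiv ℝ (fun x => ‖x‖ ^ a * u x) x‖ ^ 2 :=
      integral_nonneg fun _ => by positivity
    refine Real.rpow_le_rpow (by positivity) (h1.trans ?_) (by positivity)
    gcongr
    linarith

/-- The tangent line to `log` at `1/l`; keeping `l` free allows optimization after integration. -/
theorem Real.log_le_mul_sub_one_sub_log {l x : ℝ} (hl : 0 < l) (hx : 0 < x) :
    Real.log x ≤ l * x - 1 - Real.log l := by
  have := Real.log_le_sub_one_of_pos (mul_pos hl hx)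
  rw [Real.log_mul hl.ne' hx.ne'] at this
  linarith

/-- Optimization of the auxiliary parameters in the logarithmic inequality. -/
theorem log_bound_of_forall_parameters {n A Q C L ε : ℝ} (hn : 2 < n) (hA : 0 < A) (hQ : 0 < Q)
    (hC : 0 < C) (hε : 0 < ε)
    (h : ∀ l m : ℝ, 0 < l → 0 < m →
      L ≤ (n - 2) / 4 * (l * (A ^ (-(4 / (n - 2))) * (C * Q) ^ (n / (n - 2))) -
        (1 + Real.log l) * A ^ 2) + 1 / 2 * (m * (C * Q) - (1 + Real.log m) * A ^ 2)) :
    L ≤ ε * Q + ((-(n / 4) * (1 + Real.log (2 / (n * C))) - 1 / 2 * (1 - Real.log C)) -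
      (n + 2) / 4 * Real.log ε) * A ^ 2 := by
  have hn2 : 0 < n - 2 := by linarith
  have hn0 : 0 < n := by linarith
  set q := C * Q / A ^ 2 with hq
  have hq0 : 0 < q := by positivity
  have hCQ : C * Q = A ^ 2 * q := by rw [hq]; field_simp
  -- This `l` minimizes `l q^(n/(n-2)) - log l`; this `m` makes the boundary term contribute exactly
  -- `εQ/2`.
  have h1 := h (q ^ (-(n / (n - 2)))) (ε / C) (by positivity) (by positivity)
  have e1 : A ^ (-(4 / (n - 2))) * (C * Q) ^ (n / (n - 2)) = A ^ 2 * q ^ (n / (n - 2)) := by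
    rw [hCQ, Real.mul_rpow (by positivity) hq0.le, ← mul_assoc, ← Real.rpow_natCast A 2,
      ← Real.rpow_mul hA.le, ← Real.rpow_add hA]
    congr 2
    push_cast
    field_simp
    ring
  have e2 : q ^ (-(n / (n - 2))) * (A ^ 2 * q ^ (n / (n - 2))) = A ^ 2 := by
    rw [mul_left_comm, ← Real.rpow_add hq0]
    simp
  have e3 : (n - 2) / 4 * (A ^ 2 - (1 + -(n / (n - 2)) * Real.log q) * A ^ 2) =
      n / 4 * Real.log q * A ^ 2 := by
    field_simp
    ring
  rw [e1, e2, Real.log_rpow hq0, e3, Real.log_div hε.ne' hC.ne'] at h1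
  -- The slope is chosen so that the linear term in `q` contributes the other `εQ/2`.
  have h2 := Real.log_le_mul_sub_one_sub_log (l := ε * (2 / (n * C))) (by positivity) hq0
  rw [Real.log_mul hε.ne' (by positivity)] at h2
  have h3 : n / 4 * Real.log q * A ^ 2 ≤
      n / 4 * (ε * (2 / (n * C)) * q - 1 - (Real.log ε + Real.log (2 / (n * C)))) * A ^ 2 := by
    gcongr
  have e4 : n / 4 * (ε * (2 / (n * C)) * q) * A ^ 2 = ε * Q / 2 := by
    rw [hq]
    field_simp
    norm_num
  have e5 : ε / C * (C * Q) = ε * Q := by field_simp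
  rw [e5] at h1
  linarith

end LogHardySobolev

/-- Needed because `Metric.infDist` to the empty set is `0`, which would defeat positivity of the
distance. -/
theorem frontier_nonempty_of_isBounded {E : Type*} [NormedAddCommGroup E] [NormedSpace ℝ E]
    [Nontrivial E] {Ω : Set E} (hB : Bornology.IsBounded Ω) (hne : Ω.Nonempty) :
    (frontier Ω).Nonempty :=
  nonempty_frontier_iff.mpr ⟨hne, fun h =>
    NormedSpace.unbounded_univ ℝ E (h ▸ hB)⟩

/-- Pointwise linearization of the logarithm in the Hardy-Sobolev inequality. -/
theorem sq_mul_log_le {n t A s d l m : ℝ} (hn : 2 < n) (ht : 0 ≤ t) (hA : 0 < A) (hs : 0 < s)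
    (hd : 0 < d) (hl : 0 < l) (hm : 0 < m) :
    t ^ 2 * Real.log (t / (A * s ^ ((2 - n) / 2) * d)) ≤
      (n - 2) / 4 * (l * (A ^ (-(4 / (n - 2))) * |s ^ ((n - 2) / n) * t| ^ (2 * n / (n - 2))) -
        (1 + Real.log l) * t ^ 2) +
      1 / 2 * (m * ((d ^ 2)⁻¹ * t ^ 2) - (1 + Real.log m) * t ^ 2) := by
  have hn2 : 0 < n - 2 := by linarith
  have hn0 : 0 < n := by linarith
  rcases ht.eq_or_lt with rfl | ht
  · simp [Real.zero_rpow (by positivity : 2 * n / (n - 2) ≠ 0)]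
  set X := (t / A) ^ (4 / (n - 2)) * s ^ 2 with hX
  have hX0 : 0 < X := by positivity
  have h1 : Real.log (t / (A * s ^ ((2 - n) / 2) * d)) =
      (n - 2) / 4 * Real.log X + 1 / 2 * Real.log (d ^ 2)⁻¹ := by
    rw [hX, Real.log_div ht.ne' (by positivity), Real.log_mul (by positivity) hd.ne',
      Real.log_mul hA.ne' (by positivity), Real.log_rpow hs, Real.log_mul (by positivity)
      (by positivity), Real.log_rpow (by positivity), Real.log_div ht.ne' hA.ne', Real.log_inv,
      Real.log_pow, Real.log_pow]
    push_cast
    field_simp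
    ring
  have h2 : t ^ 2 * X =
      A ^ (-(4 / (n - 2))) * |s ^ ((n - 2) / n) * t| ^ (2 * n / (n - 2)) := by
    rw [abs_of_pos (by positivity), hX, Real.div_rpow ht.le hA.le,
      Real.mul_rpow (by positivity) ht.le, ← Real.rpow_mul hs.le, Real.rpow_neg hA.le]
    have e1 : (n - 2) / n * (2 * n / (n - 2)) = 2 := by field_simp
    have e2 : t ^ (2 * n / (n - 2)) = t ^ 2 * t ^ (4 / (n - 2)) := by
      rw [← Real.rpow_natCast, ← Real.rpow_add ht]
      congr 1
      push_cast
      field_simp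
      ring
    rw [e1, e2, Real.rpow_ofNat]
    ring
  have h3 := Real.log_le_mul_sub_one_sub_log hl hX0
  have h4 := Real.log_le_mul_sub_one_sub_log hm (by positivity : 0 < (d ^ 2)⁻¹)
  rw [h1, ← h2]
  calc _ ≤ t ^ 2 * ((n - 2) / 4 * (l * X - 1 - Real.log l) +
        1 / 2 * (m * (d ^ 2)⁻¹ - 1 - Real.log m)) := by gcongr
    _ = _ := by ring

/-- Logarithmic Hardy-Sobolev inequality on a bounded `C²` domain containing the origin. -/
theorem theorem3p3 (N : ℕ) (hN : 3 ≤ N) (Ω : Set (EuclideanSpace ℝ (Fin N)))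
    (hΩ : IsC2BoundedDomain Ω) (h0 : (0 : EuclideanSpace ℝ (Fin N)) ∈ Ω) :
    ∃ K₃ : ℝ, 0 < K₃ ∧
      ∀ u : EuclideanSpace ℝ (Fin N) → ℝ,
        IsTestFunctionOn (Ω \ {0}) u → (∀ x, 0 ≤ u x) →
        ∀ ε : ℝ, 0 < ε →
          (∫ x in Ω, u x ^ 2 *
              Real.log (u x /
                (l2NormOn Ω u * ‖x‖ ^ ((2 - (N : ℝ)) / 2) * distBoundary Ω x)))
            ≤ ε * (∫ x in Ω, (‖gradient u x‖ ^ 2 -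
                  ((N : ℝ) - 2) ^ 2 / (4 * ‖x‖ ^ 2) * u x ^ 2))
              + (K₃ - ((N : ℝ) + 2) / 4 * Real.log ε) * l2NormOn Ω u ^ 2 := by
  have hN' : (2 : ℝ) < N := by exact_mod_cast hN
  have hN2 : (0 : ℝ) < N - 2 := by linarith
  have : Nonempty (Fin N) := ⟨⟨0, by omega⟩⟩
  have hne := frontier_nonempty_of_isBounded hΩ.isBounded ⟨0, h0⟩
  obtain ⟨C, hC, hbd⟩ := hΩ.exists_hardyForm_bounds hN h0 hne
  set K := -((N : ℝ) / 4) * (1 + Real.log (2 / (N * C))) - 1 / 2 * (1 - Real.log C)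
  refine ⟨|K| + 1, by positivity, fun u htest hpos ε hε => ?_⟩
  obtain ⟨hI1, hI2, hI3⟩ := hbd u htest
  obtain ⟨husm, huc, hus⟩ := htest
  have hu : ContDiff ℝ 1 u := husm.of_le (by norm_cast)
  have huΩ : tsupport u ⊆ Ω := hus.trans Set.sdiff_subset
  have hu0 : tsupport u ⊆ {0}ᶜ := fun x hx => (hus hx).2
  have hout : ∀ x, x ∉ Ω → u x = 0 := fun x hx =>
    image_eq_zero_of_notMem_tsupport fun h => hx (huΩ h)
  have hQ := hardyForm_nonneg u
  have hform : ∫ x in Ω, (‖gradient u x‖ ^ 2 -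
      ((N : ℝ) - 2) ^ 2 / (4 * ‖x‖ ^ 2) * u x ^ 2) = hardyForm u := by
    rw [hardyForm_eq hu huc hu0]
    refine setIntegral_eq_integral_of_forall_compl_eq_zero fun x hx => ?_
    have : fderiv ℝ u x = 0 := by
      by_contra h
      exact hx (huΩ (support_fderiv_subset ℝ h))
    simp [gradient, this, hout x hx]
  have hA2 : l2NormOn Ω u ^ 2 = ∫ x, u x ^ 2 := by
    rw [l2NormOn, Real.sq_sqrt (integral_nonneg fun _ => by positivity)]
    exact setIntegral_eq_integral_of_forall_compl_eq_zero fun x hx => by simp [hout x hx]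
  rw [hform, setIntegral_eq_integral_of_forall_compl_eq_zero fun x hx => by simp [hout x hx]]
  set A := l2NormOn Ω u with hA
  -- If `A = 0`, the conventions `t / 0 = 0` and `log 0 = 0` make the left side vanish, and the
  -- right side reduces to `εQ ≥ 0`.
  rcases (show 0 ≤ A from Real.sqrt_nonneg _).eq_or_lt with hA0 | hA0
  · rw [← hA0]
    simp only [zero_mul, div_zero, Real.log_zero, mul_zero, integral_zero]
    simpa using mul_nonneg hε.le hQ
  have hQ0 : 0 < hardyForm u := by
    rw [← hA2] at hI1
    exact pos_of_mul_pos_right ((pow_pos hA0 2).trans_le hI1) hC.le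
  have hIu : Integrable (fun x => u x ^ 2) :=
    (hu.continuous.pow 2).integrable_of_hasCompactSupport huc.sq
  have hId := integrable_inv_distBoundary_sq_mul_sq (μ := volume) hΩ.isOpen hne hu.continuous
    huc huΩ
  have hIw : Integrable (fun x => |‖x‖ ^ (((N : ℝ) - 2) / N) * u x| ^ (2 * (N : ℝ) / (N - 2))) := by
    have hp : 0 < 2 * (N : ℝ) / (N - 2) := by positivity
    refine ((contDiff_rpow_mul hu hu0 _).continuous.abs.rpow_const
      fun _ => Or.inr hp.le).integrable_of_hasCompactSupport ?_
    exact huc.mono fun x hx h => hx (by simp [h, Real.zero_rpow hp.ne'])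
  have hφ : ∀ x ∈ tsupport u, 0 < A * ‖x‖ ^ ((2 - (N : ℝ)) / 2) * distBoundary Ω x :=
    fun x hx => mul_pos (mul_pos hA0 (Real.rpow_pos_of_pos (norm_pos_iff.mpr (hu0 hx)) _))
      (distBoundary_pos hΩ.isOpen hne (huΩ hx))
  -- Splitting the logarithm leaves `u · (u log u)`, continuous because `t log t` is continuous at
  -- `0`, and the logarithm of a weight that is continuous and positive on the support.
  have hIL : Integrable (fun x => u x ^ 2 *
      Real.log (u x / (A * ‖x‖ ^ ((2 - (N : ℝ)) / 2) * distBoundary Ω x))) := by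
    have h1 : Integrable (fun x => u x * (u x * Real.log (u x))) :=
      (hu.continuous.mul (Real.continuous_mul_log.comp
        hu.continuous)).integrable_of_hasCompactSupport huc.mul_right
    have h2 : Integrable (fun x =>
        Real.log (A * ‖x‖ ^ ((2 - (N : ℝ)) / 2) * distBoundary Ω x) * u x ^ 2) := by
      refine integrable_mul_of_continuousAt_tsupport (hu.continuous.pow 2) huc.sq fun x hx => ?_
      have hx' := tsupport_sq_subset u hx
      exact ((continuousAt_const.mul
        (contDiffAt_norm_rpow (n := 0) (hu0 hx') _).continuousAt).mul
          (continuous_distBoundary Ω).continuousAt).log (hφ x hx').ne'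
    refine (h1.sub h2).congr (Filter.Eventually.of_forall fun x => ?_)
    by_cases hx : u x = 0
    · simp [hx]
    · have := hφ x (subset_tsupport u hx)
      simp only [Pi.sub_apply]
      rw [Real.log_div hx this.ne']
      ring
  have hmain := log_bound_of_forall_parameters hN' hA0 hQ0 hC hε (L := ∫ x, u x ^ 2 *
      Real.log (u x / (A * ‖x‖ ^ ((2 - (N : ℝ)) / 2) * distBoundary Ω x))) fun l m hl hm => by
    have hb1 := ((hIw.const_mul (A ^ (-(4 / ((N : ℝ) - 2))))).const_mul l).sub
      (hIu.const_mul (1 + Real.log l))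
    have hb2 := (hId.const_mul m).sub (hIu.const_mul (1 + Real.log m))
    have h1 := integral_mono hIL ((hb1.const_mul (((N : ℝ) - 2) / 4)).add
      (hb2.const_mul (1 / 2))) fun x => by
        by_cases hx : x ∈ tsupport u
        · exact sq_mul_log_le hN' (hpos x) hA0 (norm_pos_iff.mpr (hu0 hx))
            (distBoundary_pos hΩ.isOpen hne (huΩ hx)) hl hm
        · have hp : 2 * (N : ℝ) / (N - 2) ≠ 0 := by positivity
          simp [image_eq_zero_of_notMem_tsupport hx, Real.zero_rpow hp]
    refine h1.trans ?_
    rw [integral_add' (hb1.const_mul _) (hb2.const_mul _), integral_const_mul, integral_const_mul,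
      integral_sub' ((hIw.const_mul _).const_mul _) (hIu.const_mul _),
      integral_sub' (hId.const_mul _) (hIu.const_mul _)]
    simp only [integral_const_mul]
    rw [← hA2]
    gcongr
  refine hmain.trans ?_
  gcongr
  exact (le_abs_self K).trans (by linarith)
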